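/- Fix a base $b>1$ for all logarithms $\log$ (the exponential $\exp$ is the natural one). Let $P_X$ be a probability mass function on a finite alphabet $\mathcal X$, and let $H(P_X)=-\sum_{x}P_X(x)\log P_X(x)$ be its Shannon entropy. For integers $M,L$ let $N=ML$, let $X^N=(X_1,\dots,X_N)$ be i.i.d. from $P_X$, and cut $X^N$ into the $M$ consecutive fragments $\boldsymbol X(i)=(X_{(i-1)L+1},\dots,X_{iL})$, $1\le i\le M$. Let $$\mathcal A_L(X^N)=\{(\boldsymbol X(\pi(1)),\dots,\boldsymbol X(\pi(M))) : \pi\in S_M\}$$ be the set of distinct sequences obtained by reordering the fragments. Proposition. There is a numerical constant $c>0$ such that the following holds. Assume $H(P_X)>0$ and let $\beta>0$, $\eta\in(0,1)$. Then there is $M_0=M_0(P_X,\beta,\eta)$ (which may also depend on the base $b$) such that for all integers $M\ge M_0$ and every integer $L\geq 0$ with $|L-\beta\log M|\le 1$ (that is, $L=\beta\log M$ up to rounding), $$\mathbb P\Big[\tfrac1M\log|\mathcal A_L(X^N)|\ \ge\ L\cdot H(P_X)+\eta\log M\Big]\ \le\ \begin{cases}\exp[-c\,\eta^2M], & 0<\beta<2,\\[2pt]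 2/M^{\eta/2}, & \beta\ge 2.\end{cases}$$ In particular, for $0<\beta<2$ the probability is $\exp[-\Omega(\eta^2M^{1\wedge(2-\beta)})]$, where $1\wedge(2-\beta)=\min\{1,2-\beta\}$. -/

import Mathlib

open MeasureTheory

namespace FragmentReordering

noncomputable section

/-- Shannon entropy of a PMF on a finite alphabet, with logarithms to base `b`
(and `0 log 0 = 0`). -/
def shannonEntropy (b : ℝ) {𝒳 : Type*} [Fintype 𝒳] (P : PMF 𝒳) : ℝ :=
  -∑ x, (P x).toReal * Real.logb b (P x).toReal

/-- The law of a sequence of `N` symbols drawn independently from `P`. -/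
def iidLaw {𝒳 : Type*} [MeasurableSpace 𝒳] (P : PMF 𝒳) (N : ℕ) : Measure (Fin N → 𝒳) :=
  Measure.pi fun _ => P.toMeasure

/-- The `i`-th of the `M` consecutive, non-overlapping fragments of length `L` of a sequence of
length `M * L`; `finProdFinEquiv (i, j)` is the position `L * i + j`, counted from `0`. -/
def fragment {𝒳 : Type*} {M L : ℕ} (x : Fin (M * L) → 𝒳) (i : Fin M) : Fin L → 𝒳 :=
  fun j => x (finProdFinEquiv (i, j))

/-- The sequence whose `i`-th fragment is the `π i`-th fragment of `x`. -/
def reorder {𝒳 : Type*} {M L : ℕ} (π : Equiv.Perm (Fin M)) (x : Fin (M * L) → 𝒳) :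
    Fin (M * L) → 𝒳 :=
  fun n => fragment x (π (finProdFinEquiv.symm n).1) (finProdFinEquiv.symm n).2

/-- The set of all sequences obtained from `x` by reordering its `M` fragments of length `L`. -/
def reconstructions {𝒳 : Type*} (M L : ℕ) (x : Fin (M * L) → 𝒳) : Set (Fin (M * L) → 𝒳) :=
  Set.range fun π : Equiv.Perm (Fin M) => reorder π x

/-- The event that the normalized log-cardinality of the set of reconstructions is at least
`L * H(P) + η * log M`, all logarithms being to base `b`. -/
def manyReconstructions (b : ℝ) {𝒳 : Type*} [Fintype 𝒳] (P : PMF 𝒳) (η : ℝ) (M L : ℕ) :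
    Set (Fin (M * L) → 𝒳) :=
  {x | (1 / (M : ℝ)) * Real.logb b ((reconstructions M L x).ncard : ℝ)
      ≥ (L : ℝ) * shannonEntropy b P + η * Real.logb b (M : ℝ)}

end

end FragmentReordering

open ProbabilityTheory Filter

namespace FragmentReordering

/-! Permuting fragments preserves the i.i.d. probability, so `log |A|` is at most the
self-information of the sequence (`logb_ncard_reconstructions_le`): a sum of `M * L` independent
bounded terms of mean `H`. The event thus forces an excess of `η M log M` over the mean. With terms
in `[0, K]`, Hoeffding bounds its probability by `exp(-2 η² M log² M / (L K²))`. As `L ~ β log M`,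
the exponent has order `η² M log M`, which eventually beats `η² M` for every `β`; the bound for `β ≥
2` is weaker still. -/

theorem prod_reorder {𝒳 R : Type*} [CommMonoid R] {M L : ℕ} (w : 𝒳 → R)
    (π : Equiv.Perm (Fin M)) (x : Fin (M * L) → 𝒳) :
    ∏ n, w (reorder π x n) = ∏ n, w (x n) := by
  rw [← finProdFinEquiv.prod_comp, ← finProdFinEquiv.prod_comp (fun n => w (x n)),
    Fintype.prod_prod_type, Fintype.prod_prod_type]
  simp only [reorder, fragment, Equiv.symm_apply_apply]
  exact Equiv.prod_comp π fun i => ∏ j, w (x (finProdFinEquiv (i, j)))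

theorem sum_toReal_pmf {𝒳 : Type*} [Fintype 𝒳] (P : PMF 𝒳) : ∑ a, (P a).toReal = 1 := by
  rw [← ENNReal.toReal_sum fun a _ => P.apply_ne_top a, ← tsum_fintype (L := .unconditional _),
    P.tsum_coe, ENNReal.toReal_one]

/-- All reorderings of a sequence are equally likely, so their number is at most the inverse of
the probability of the sequence. -/
theorem ncard_reconstructions_mul_le_one {𝒳 : Type*} [Fintype 𝒳] (P : PMF 𝒳) {M L : ℕ}
    (x : Fin (M * L) → 𝒳) :
    ((reconstructions M L x).ncard : ℝ) * ∏ n, (P (x n)).toReal ≤ 1 := by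
  classical
  have hfin : (reconstructions M L x).Finite := Set.toFinite _
  calc ((reconstructions M L x).ncard : ℝ) * ∏ n, (P (x n)).toReal
      = ∑ z ∈ hfin.toFinset, ∏ n, (P (z n)).toReal := by
        rw [Set.ncard_eq_toFinset_card _ hfin, ← nsmul_eq_mul]
        refine (Finset.sum_eq_card_nsmul fun z hz => ?_).symm
        obtain ⟨π, rfl⟩ := hfin.mem_toFinset.1 hz
        exact prod_reorder (fun a => (P a).toReal) π x
    _ ≤ ∑ z : Fin (M * L) → 𝒳, ∏ n, (P (z n)).toReal :=
        Finset.sum_le_sum_of_subset_of_nonneg (Finset.subset_univ _) fun z _ _ =>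
          Finset.prod_nonneg fun n _ => ENNReal.toReal_nonneg
    _ = 1 := by
        rw [← Fintype.prod_sum fun (_ : Fin (M * L)) a => (P a).toReal]
        simp [sum_toReal_pmf]

theorem logb_ncard_reconstructions_le {𝒳 : Type*} [Fintype 𝒳] (P : PMF 𝒳) {b : ℝ} (hb : 1 < b)
    {M L : ℕ} (x : Fin (M * L) → 𝒳) (hx : ∀ n, P (x n) ≠ 0) :
    Real.logb b ((reconstructions M L x).ncard : ℝ) ≤ ∑ n, -Real.logb b (P (x n)).toReal := by
  have hpos : ∀ n, 0 < (P (x n)).toReal := fun n =>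
    ENNReal.toReal_pos (hx n) (P.apply_ne_top _)
  have hcard : 0 < ((reconstructions M L x).ncard : ℝ) := by
    exact_mod_cast (Set.ncard_pos (Set.toFinite _)).2 (Set.range_nonempty _)
  have hprod : 0 < ∏ n, (P (x n)).toReal := Finset.prod_pos fun n _ => hpos n
  have h := Real.logb_le_logb_of_le hb (mul_pos hcard hprod)
    (ncard_reconstructions_mul_le_one P x)
  rw [Real.logb_mul hcard.ne' hprod.ne', Real.logb_one,
    Real.logb_prod _ _ fun n _ => (hpos n).ne'] at h
  rw [Finset.sum_neg_distrib]
  linarith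

theorem integral_neg_logb_pmf {𝒳 : Type*} [Fintype 𝒳] [MeasurableSpace 𝒳]
    [MeasurableSingletonClass 𝒳] (P : PMF 𝒳) (b : ℝ) :
    ∫ a, -Real.logb b (P a).toReal ∂P.toMeasure = shannonEntropy b P := by
  rw [PMF.integral_eq_sum]
  simp [shannonEntropy]

/-- Since `Real.logb b 0 = 0`, a null symbol would count as carrying no information, so the counting
bound is only claimed off this null set. -/
theorem ae_iidLaw_ne_zero {𝒳 : Type*} [Fintype 𝒳] [MeasurableSpace 𝒳]
    [MeasurableSingletonClass 𝒳] (P : PMF 𝒳) (N : ℕ) :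
    ∀ᵐ x ∂iidLaw P N, ∀ n, P (x n) ≠ 0 := by
  have h : ∀ᵐ a ∂P.toMeasure, P a ≠ 0 := by
    rw [ae_iff, PMF.toMeasure_apply_eq_zero_iff _ (Set.toFinite _).measurableSet,
      Set.disjoint_left]
    intro a ha
    simpa using (P.mem_support_iff a).1 ha
  rw [ae_all_iff]
  intro n
  exact (Measure.quasiMeasurePreserving_eval (fun _ : Fin N => P.toMeasure) n).ae h

/-- Hoeffding's inequality for the self-information of an i.i.d. sequence. -/
theorem iidLaw_sum_neg_logb_ge_le {𝒳 : Type*} [Fintype 𝒳] [MeasurableSpace 𝒳]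
    [MeasurableSingletonClass 𝒳] (P : PMF 𝒳) {b K : ℝ}
    (hK : ∀ a, -Real.logb b (P a).toReal ∈ Set.Icc 0 K) (N : ℕ) {ε : ℝ} (hε : 0 ≤ ε) :
    (iidLaw P N).real
        {x | N * shannonEntropy b P + ε ≤ ∑ n, -Real.logb b (P (x n)).toReal}
      ≤ Real.exp (-(2 * ε ^ 2 / (N * K ^ 2))) := by
  have : IsProbabilityMeasure (iidLaw P N) := by unfold iidLaw; infer_instance
  let f : 𝒳 → ℝ := fun a => -Real.logb b (P a).toReal
  have hf : Measurable f := measurable_of_finite f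
  have hmean (n : Fin N) : ∫ x, f (x n) ∂iidLaw P N = shannonEntropy b P :=
    (integral_comp_eval (μ := fun _ : Fin N => P.toMeasure)
      hf.aestronglyMeasurable).trans (integral_neg_logb_pmf P b)
  have hsub (n : Fin N) : HasSubgaussianMGF
      (fun x : Fin N → 𝒳 => f (x n) - shannonEntropy b P) ((‖K - 0‖₊ / 2) ^ 2) (iidLaw P N) := by
    have h := hasSubgaussianMGF_of_mem_Icc (μ := iidLaw P N) (X := fun x : Fin N → 𝒳 => f (x n))
      (hf.comp (measurable_pi_apply n)).aemeasurable (ae_of_all _ fun x => hK (x n))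
    rwa [hmean n] at h
  have hind : iIndepFun (fun (n : Fin N) (x : Fin N → 𝒳) => f (x n) - shannonEntropy b P)
      (iidLaw P N) :=
    iIndepFun_pi (μ := fun _ : Fin N => P.toMeasure) fun _ => (hf.sub_const _).aemeasurable
  have h := HasSubgaussianMGF.measure_sum_ge_le_of_iIndepFun hind (s := Finset.univ)
    (fun n _ => hsub n) hε
  convert h using 2
  · ext x
    simp only [Set.mem_ofPred_eq, Finset.sum_sub_distrib, Finset.sum_const, Finset.card_univ,
      Fintype.card_fin, nsmul_eq_mul]
    exact ⟨fun h => by linarith, fun h => by linarith⟩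
  · rw [Finset.sum_const, Finset.card_univ, Fintype.card_fin, nsmul_eq_mul]
    push_cast
    rw [sub_zero, div_pow, Real.norm_eq_abs, sq_abs,
      show 2 * ((N : ℝ) * (K ^ 2 / 2 ^ 2)) = N * K ^ 2 / 2 by ring, div_div_eq_mul_div]
    ring

theorem exists_neg_logb_pmf_mem_Icc {𝒳 : Type*} [Fintype 𝒳] (P : PMF 𝒳) {b : ℝ} (hb : 1 < b) :
    ∃ K : ℝ, 0 < K ∧ ∀ a, -Real.logb b (P a).toReal ∈ Set.Icc 0 K := by
  have hnn (a : 𝒳) : 0 ≤ -Real.logb b (P a).toReal :=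
    neg_nonneg.2 (Real.logb_nonpos hb ENNReal.toReal_nonneg
      (ENNReal.toReal_le_of_le_ofReal zero_le_one (by simpa using P.coe_le_one a)))
  -- The sum dominates each term; the extra `1` makes `K` positive, so that Hoeffding's denominator
  -- does not vanish.
  refine ⟨1 + ∑ a, -Real.logb b (P a).toReal,
    add_pos_of_pos_of_nonneg one_pos (Finset.sum_nonneg fun a _ => hnn a), fun a => ⟨hnn a, ?_⟩⟩
  have := Finset.single_le_sum (fun a _ => hnn a) (Finset.mem_univ a)
  linarith

theorem iidLaw_manyReconstructions_le {𝒳 : Type*} [Fintype 𝒳] [MeasurableSpace 𝒳]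
    [MeasurableSingletonClass 𝒳] (P : PMF 𝒳) {b K η : ℝ} (hb : 1 < b)
    (hK : ∀ a, -Real.logb b (P a).toReal ∈ Set.Icc 0 K) (hη : 0 ≤ η) {M : ℕ} (hM : 0 < M)
    (L : ℕ) :
    (iidLaw P (M * L)).real (manyReconstructions b P η M L)
      ≤ Real.exp (-(2 * (η * M * Real.logb b M) ^ 2 / (((M * L : ℕ) : ℝ) * K ^ 2))) := by
  have : IsProbabilityMeasure (iidLaw P (M * L)) := by unfold iidLaw; infer_instance
  have hM' : (0 : ℝ) < M := by exact_mod_cast hM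
  have hlog : 0 ≤ Real.logb b M := Real.logb_nonneg hb (by exact_mod_cast hM)
  refine le_trans (ENNReal.toReal_mono (measure_ne_top _ _) (measure_mono_ae ?_))
    (iidLaw_sum_neg_logb_ge_le P hK (M * L) (by positivity))
  filter_upwards [ae_iidLaw_ne_zero P (M * L)] with x hx hmany
  refine le_trans ?_ (logb_ncard_reconstructions_le P hb x hx)
  have h : (L : ℝ) * shannonEntropy b P + η * Real.logb b M
      ≤ 1 / (M : ℝ) * Real.logb b ((reconstructions M L x).ncard : ℝ) := hmany
  rw [one_div_mul_eq_div, le_div_iff₀ hM'] at h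
  push_cast
  linarith

theorem eventually_rpow_le_exp {η : ℝ} (hη : 0 < η) :
    ∀ᶠ M : ℕ in atTop, (M : ℝ) ^ (η / 2) ≤ Real.exp (η ^ 2 * M) := by
  have h := (isLittleO_rpow_exp_pos_mul_atTop (η / 2) (pow_pos hη 2)).bound one_pos
  filter_upwards [tendsto_natCast_atTop_atTop.eventually h] with M hM
  rw [one_mul, Real.norm_of_nonneg (Real.exp_pos _).le] at hM
  exact (Real.le_norm_self _).trans hM

/-- For `L` within `1` of `β log M`, the first bound gives `L > 0` and the second `L K² ≤ 2 log² M`.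
-/
theorem eventually_logb_large {b β K : ℝ} (hb : 1 < b) (hβ : 0 < β) :
    ∀ᶠ M : ℕ in atTop, 1 < β * Real.logb b M ∧
      (β * Real.logb b M + 1) * K ^ 2 ≤ 2 * Real.logb b M ^ 2 := by
  have h := (Real.tendsto_logb_atTop hb).comp (tendsto_natCast_atTop_atTop (R := ℝ))
  filter_upwards [h.eventually_gt_atTop β⁻¹, h.eventually_ge_atTop (β * K ^ 2)] with M h1 h2
  simp only [Function.comp_apply] at h1 h2
  have h3 : 1 < β * Real.logb b M := by
    rwa [inv_eq_one_div, div_lt_iff₀' hβ] at h1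
  have h4 : 0 < Real.logb b M := (inv_pos.2 hβ).trans h1
  refine ⟨h3, ?_⟩
  calc (β * Real.logb b M + 1) * K ^ 2 ≤ (2 * (β * Real.logb b M)) * K ^ 2 := by
        gcongr; linarith
    _ = 2 * (Real.logb b M * (β * K ^ 2)) := by ring
    _ ≤ 2 * (Real.logb b M * Real.logb b M) := by gcongr
    _ = 2 * Real.logb b M ^ 2 := by ring

end FragmentReordering

theorem mainTheorem4 :
    ∃ c : ℝ, 0 < c ∧
      ∀ (𝒳 : Type*) [Fintype 𝒳] [MeasurableSpace 𝒳] [MeasurableSingletonClass 𝒳]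
        (P : PMF 𝒳) (b β : ℝ), 1 < b → 0 < β →
        0 < FragmentReordering.shannonEntropy b P →
        ∀ η : ℝ, 0 < η → η < 1 →
          ∃ M₀ : ℕ, ∀ M L : ℕ, M₀ ≤ M → |(L : ℝ) - β * Real.logb b (M : ℝ)| ≤ 1 →
            (β < 2 →
              (FragmentReordering.iidLaw P (M * L)).real
                  (FragmentReordering.manyReconstructions b P η M L)
                ≤ Real.exp (-(c * η ^ 2 * (M : ℝ)))) ∧
            (2 ≤ β →
              (FragmentReordering.iidLaw P (M * L)).real
                  (FragmentReordering.manyReconstructions b P η M L)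
                ≤ 2 / (M : ℝ) ^ (η / 2)) := by
  -- The spare factor `log M` in the exponent absorbs `β` and `K`, so `c = 1` works once `M` is
  -- large.
  refine ⟨1, one_pos, ?_⟩
  intro 𝒳 _ _ _ P b β hb hβ _ η hη _
  obtain ⟨K, hK0, hK⟩ := FragmentReordering.exists_neg_logb_pmf_mem_Icc P hb
  obtain ⟨M₀, hM₀⟩ := eventually_atTop.1
    (((FragmentReordering.eventually_logb_large (K := K) hb hβ).and
      (FragmentReordering.eventually_rpow_le_exp hη)).and (eventually_gt_atTop 0))
  refine ⟨M₀, fun M L hM hL => ?_⟩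
  obtain ⟨⟨⟨hlog, hsq⟩, hexp⟩, hMpos⟩ := hM₀ M hM
  obtain ⟨hL1, hL2⟩ := abs_le.1 hL
  have hM' : (0 : ℝ) < M := by exact_mod_cast hMpos
  have hL0 : (0 : ℝ) < L := by linarith
  have key : (FragmentReordering.iidLaw P (M * L)).real
      (FragmentReordering.manyReconstructions b P η M L) ≤ Real.exp (-(η ^ 2 * M)) := by
    refine (FragmentReordering.iidLaw_manyReconstructions_le P hb hK hη.le hMpos L).trans ?_
    rw [Real.exp_le_exp, neg_le_neg_iff]
    push_cast
    rw [le_div_iff₀ (by positivity)]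
    calc η ^ 2 * M * (M * L * K ^ 2) = η ^ 2 * M ^ 2 * (L * K ^ 2) := by ring
      _ ≤ η ^ 2 * M ^ 2 * (2 * Real.logb b M ^ 2) := by
        refine mul_le_mul_of_nonneg_left (le_trans ?_ hsq) (by positivity)
        gcongr
        linarith
      _ = 2 * (η * M * Real.logb b M) ^ 2 := by ring
  refine ⟨fun _ => by rwa [one_mul], fun _ => key.trans ?_⟩
  have hpow : 0 < (M : ℝ) ^ (η / 2) := Real.rpow_pos_of_pos hM' _
  -- What remains is `hexp` with a factor `2` to spare.
  rw [Real.exp_neg, le_div_iff₀ hpow, inv_mul_le_iff₀ (Real.exp_pos _)]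
  linarith [Real.exp_pos (η ^ 2 * M)]
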